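/- All graphs are finite, simple, undirected and connected. The degeneracy of a graph $G$ is the maximum of the minimum degree $\delta(H)$ over all subgraphs $H$ of $G$. In the localization game with $m\ge 1$ cops on $G$, the robber secretly chooses a starting vertex; in each round the cops choose vertices $u_1,\dots,u_m$ (not necessarily distinct) and learn the distances $d_G(u_i,r)$ from these vertices to the robber's current vertex $r$, after which the robber stays put or moves to a neighboring vertex. The cops, who may adapt their choices to all distances observed so far, win if after finitely many rounds the robber's current vertex is uniquely determined by everything observed. The localization number of $G$ is the least positive integer $m$ for which $m$ cops have a strategy that wins against every robber. For an integer $k\ge 1$, let $G_k$ be the following graph. Start with the $k$-fold strong product of copies of the cycle $C_{40}$; its vertices, called core vertices, are the vectors in $\{0,1,\dots,39\}^k$, and two distinct ones are adjacent if and only if they differ by at most $1$ modulo $40$ in every coordinate. For each $i\in\{1,\dots,k\}$ and $t\in\{0,10\}$ add a satellite vertex $s_{i,t}$, and connect it to every core vertex $w$ with $w_i=t$ by a path of length $40$ (a subdivided edge), these paths being pairwise internally disjoint and with new internal vertices. Theorem 2.4. For every integer $k\ge 1$, the graph $G_k$ has degeneracy $3^k-1$ and localization number $k$. -/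

import Mathlib

namespace LocGame

open Classical in
/-- The degeneracy of a finite graph `G`: the maximum, over all subgraphs `H` of `G`, of the
minimum degree `δ(H)`. (A finite graph has finitely many subgraphs, so the supremum is attained;
the empty subgraph contributes `0`.) -/
noncomputable def degeneracy {V : Type*} [Fintype V] (G : SimpleGraph V) : ℕ :=
  ⨆ H : G.Subgraph, H.coe.minDegree

/-! ### The localization game -/

/-- A strategy of `m` cops: from the list of the distance vectors observed so far (most recent
first), the next placement of the `m` cops. Their own past placements are determined by that
list. -/
abbrev CopStrategy (V : Type*) (m : ℕ) : Type _ := List (Fin m → ℕ) → (Fin m → V)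

/-- A sequence of robber positions: `x n` is the robber's position when the cops make their
`n`-th probe (counted from `0`). In between he stays put or moves to a neighbor. -/
def IsRobberWalk {V : Type*} (G : SimpleGraph V) (x : ℕ → V) : Prop :=
  ∀ n, x (n + 1) = x n ∨ G.Adj (x n) (x (n + 1))

/-- The distance vectors observed during the first `n` probes, most recent first, when the cops
play `σ` and the robber's positions are `x`. -/
noncomputable def observations {V : Type*} (G : SimpleGraph V) {m : ℕ} (σ : CopStrategy V m)
    (x : ℕ → V) : ℕ → List (Fin m → ℕ)
  | 0 => []
  | n + 1 => (fun i => G.dist (σ (observations G σ x n) i) (x n)) :: observations G σ x n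

/-- With the probe number `n` the cops determine the robber's position: it is the only position
compatible with the rules of movement and with everything observed so far. -/
def LocatedAt {V : Type*} (G : SimpleGraph V) {m : ℕ} (σ : CopStrategy V m) (x : ℕ → V)
    (n : ℕ) : Prop :=
  ∀ y : ℕ → V, IsRobberWalk G y →
    observations G σ y (n + 1) = observations G σ x (n + 1) → y n = x n

/-- `m` cops have a strategy that locates every robber after finitely many rounds. -/
def CopsWin {V : Type*} (G : SimpleGraph V) (m : ℕ) : Prop :=
  ∃ σ : CopStrategy V m, ∀ x : ℕ → V, IsRobberWalk G x → ∃ n, LocatedAt G σ x n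

/-- The localization number of a (finite, connected) graph: the least positive number of cops
that have a winning strategy. -/
noncomputable def localizationNumber {V : Type*} (G : SimpleGraph V) : ℕ :=
  sInf {m : ℕ | 0 < m ∧ CopsWin G m}

/-! ### The graphs `G_k` -/

/-- The `k`-fold strong product of copies of `G`: distinct vectors are adjacent when in every
coordinate their entries are equal or adjacent. -/
def strongPower {V : Type*} (G : SimpleGraph V) (k : ℕ) : SimpleGraph (Fin k → V) where
  Adj u v := u ≠ v ∧ ∀ i, u i = v i ∨ G.Adj (u i) (v i)
  symm := ⟨fun _ _ h => ⟨h.1.symm, fun i => (h.2 i).imp Eq.symm fun a => a.symm⟩⟩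
  loopless := ⟨fun _ h => h.1 rfl⟩

/-- The two values `0` and `10` that index the satellites of one coordinate. -/
def anchor : Bool → Fin 40
  | false => 0
  | true => 10

/-- The vertices of `G_k`. The satellite `satellite i b` is joined by a thread of length `40` to
every core vertex `w` with `w i = anchor b`; the `39` internal vertices of this thread are
`thread i b w j`, the one numbered `j` being `j + 1` steps away from the satellite. -/
inductive GVertex (k : ℕ) : Type
  | core (w : Fin k → Fin 40)
  | satellite (i : Fin k) (b : Bool)
  | thread (i : Fin k) (b : Bool) (w : {w : Fin k → Fin 40 // w i = anchor b}) (j : Fin 39)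
  deriving DecidableEq, Fintype

/-- The edges of `G_k`, each given in one direction: the edges of the core, and the edges of the
threads, directed from the satellite to the core. -/
def GEdge (k : ℕ) : GVertex k → GVertex k → Prop
  | .core u, .core v => (strongPower (SimpleGraph.cycleGraph 40) k).Adj u v
  | .satellite i b, .thread i' b' _ j => i = i' ∧ b = b' ∧ (j : ℕ) = 0
  | .thread i b w j, .thread i' b' w' j' =>
      i = i' ∧ b = b' ∧ w.1 = w'.1 ∧ (j : ℕ) + 1 = (j' : ℕ)
  | .thread _ _ w j, .core v => w.1 = v ∧ (j : ℕ) = 38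
  | _, _ => False

/-- The graph `G_k`: the `k`-fold strong product of copies of `C₄₀`, with `2k` satellites attached
by threads of length `40`. -/
def G (k : ℕ) : SimpleGraph (GVertex k) := SimpleGraph.fromRel (GEdge k)

end LocGame

/-!
**Degeneracy.** The core is regular of degree `3 ^ k - 1`. A subgraph with a vertex inside a thread
has minimum degree at most `2`, and in a subgraph without such vertices each satellite is isolated
and each other vertex has its neighbors in the core.

**Fewer than `k` cops do not suffice** (`not_copsWin_of_card`). The distances from a fixed vertex
to the closed neighborhood of `v` take at most three values, so `m < k` cops get at most `3 ^ m`
answers on the `3 ^ k` core vertices of a closed neighborhood. A robber in the core can therefore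
always move to one of two positions between which the next probe does not distinguish.

**`k` cops suffice** (`wins_univ`). A strategy is built backwards on sets of possible positions
(`Wins`). Except in one situation, the cops probe one satellite for each coordinate. Such a
satellite is at distance `40` plus the cyclic distance of a coordinate to an anchor from a core
vertex, and the distance grows by `1` with each step that the robber takes away from the core into
the thread of another satellite. Two observations make the strategy work.

* A robber seen on a thread of a probed satellite is lost (`winsAfterProbe_of_lt`). One cop keeps
  probing this satellite, so the robber cannot pass through it, and the thread is long enough for
  the others to find its end before he reaches it. Near the satellite, where the distances to the
  other satellites say too little, they probe the possible ends in the core one by one.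
* Otherwise the robber is in the core or next to it after the probes of all first and of all second
  anchors, and each coordinate is known up to few exceptions, which the next probe resolves
  (`consistent_consistent_subset_nearCore`, `anchorDist_injOn_spread`). From then on the only way
  to evade is the ambiguity between a core vertex `v` and the last vertex of a thread to `w`, where
  every coordinate of `v` is that of `w` moved by `1` away from the probed anchor. This goes on
  only if every coordinate moves away from the probed anchor in every round. The cops choose the
  anchors so that after at most `11` rounds this drives all coordinates away from the anchors for
  good; then there is no thread to enter (`winsAfterProbe_of_settled`).
-/

namespace LocGame

/-! ### The game on belief sets -/

section Game

variable {V : Type*} {G : SimpleGraph V} {m : ℕ}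

/-- The possible positions of the robber after a move, when `S` is the set of possible positions
before it. -/
def afterMove (G : SimpleGraph V) (S : Set V) : Set V :=
  {y | ∃ x ∈ S, y = x ∨ G.Adj x y}

/-- The positions in `S` at which the probe `u` returns the distances `d`. -/
def consistent (G : SimpleGraph V) (S : Set V) (u : Fin m → V) (d : Fin m → ℕ) : Set V :=
  {y | y ∈ S ∧ ∀ i, G.dist (u i) y = d i}

/-- `m` cops who know that the robber is in `S`, and whose turn it is to probe, can locate him:
some probe is such that each answer either locates him or leaves a winning position after his
next move. As the definition is inductive, every play is finite. -/
inductive Wins (G : SimpleGraph V) (m : ℕ) : Set V → Prop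
  | probe (S : Set V) (u : Fin m → V)
      (h : ∀ d, ¬ (consistent G S u d).Subsingleton → Wins G m (afterMove G (consistent G S u d))) :
      Wins G m S

/-- The same as `Wins`, at the moment after a probe: the robber is located or the cops win from
the positions he can move to. -/
def WinsAfterProbe (G : SimpleGraph V) (m : ℕ) (S : Set V) : Prop :=
  ¬ S.Subsingleton → Wins G m (afterMove G S)

theorem afterMove_mono {S T : Set V} (h : S ⊆ T) : afterMove G S ⊆ afterMove G T :=
  fun _ ⟨x, hx, hy⟩ => ⟨x, h hx, hy⟩

theorem consistent_mono {S T : Set V} (h : S ⊆ T) (u : Fin m → V) (d : Fin m → ℕ) :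
    consistent G S u d ⊆ consistent G T u d :=
  fun _ ⟨hx, hy⟩ => ⟨h hx, hy⟩

theorem Wins.mono {S T : Set V} (h : Wins G m T) (hST : S ⊆ T) : Wins G m S := by
  induction h generalizing S with
  | probe T u _ ih =>
    refine .probe S u fun d hd => ?_
    exact ih d (fun hs => hd (hs.anti (consistent_mono hST u d)))
      (afterMove_mono (consistent_mono hST u d))

theorem WinsAfterProbe.mono {S T : Set V} (h : WinsAfterProbe G m T) (hST : S ⊆ T) :
    WinsAfterProbe G m S :=
  fun hS => (h fun hT => hS (hT.anti hST)).mono (afterMove_mono hST)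

theorem WinsAfterProbe.of_subsingleton {S : Set V} (h : S.Subsingleton) : WinsAfterProbe G m S :=
  fun h' => absurd h h'

theorem WinsAfterProbe.of_wins {S : Set V} (h : Wins G m (afterMove G S)) :
    WinsAfterProbe G m S :=
  fun _ => h

/-- The strategy that probes `u` first and continues with `τ d` after the answer `d`. The oldest
answer is the last entry of the list of observations. -/
def firstProbe (u : Fin m → V) (τ : (Fin m → ℕ) → CopStrategy V m) : CopStrategy V m :=
  fun l => match l.getLast? with
    | none => u
    | some d => τ d l.dropLast

theorem observations_firstProbe (u : Fin m → V) (τ : (Fin m → ℕ) → CopStrategy V m) (x : ℕ → V)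
    (n : ℕ) :
    observations G (firstProbe u τ) x (n + 1) =
      observations G (τ fun i => G.dist (u i) (x 0)) (fun j => x (j + 1)) n ++
        [fun i => G.dist (u i) (x 0)] := by
  induction n with
  | zero => simp [observations, firstProbe]
  | succ n ih =>
    rw [observations, ih, observations]
    simp [firstProbe]

/-- The strategy for an initial set `S`, against robbers who start in `S`. -/
theorem Wins.exists_strategy {S : Set V} (h : Wins G m S) :
    ∃ σ : CopStrategy V m, ∀ x, IsRobberWalk G x → x 0 ∈ S → ∃ n, ∀ y, IsRobberWalk G y →
      y 0 ∈ S → observations G σ y (n + 1) = observations G σ x (n + 1) → y n = x n := by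
  induction h with
  | probe S u _ ih =>
    have ih' : ∀ d, ∃ σ : CopStrategy V m, ¬ (consistent G S u d).Subsingleton →
        ∀ x, IsRobberWalk G x → x 0 ∈ afterMove G (consistent G S u d) → ∃ n, ∀ y,
          IsRobberWalk G y → y 0 ∈ afterMove G (consistent G S u d) →
          observations G σ y (n + 1) = observations G σ x (n + 1) → y n = x n := by
      intro d
      by_cases hd : (consistent G S u d).Subsingleton
      · exact ⟨fun _ => u, fun h => absurd hd h⟩
      · obtain ⟨σ, hσ⟩ := ih d hd
        exact ⟨σ, fun _ => hσ⟩
    choose τ hτ using ih'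
    refine ⟨firstProbe u τ, fun x hx hx0 => ?_⟩
    by_cases hd : (consistent G S u fun i => G.dist (u i) (x 0)).Subsingleton
    · refine ⟨0, fun y _ hy0 hobs => hd ⟨hy0, fun i => ?_⟩ ⟨hx0, fun _ => rfl⟩⟩
      rw [observations_firstProbe, observations_firstProbe] at hobs
      simp only [observations, List.nil_append, List.cons.injEq, and_true] at hobs
      exact congrFun hobs i
    · obtain ⟨n, hn⟩ := hτ _ hd (fun j => x (j + 1)) (fun j => hx (j + 1))
        ⟨x 0, ⟨hx0, fun _ => rfl⟩, hx 0⟩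
      refine ⟨n + 1, fun y hy hy0 hobs => ?_⟩
      rw [observations_firstProbe, observations_firstProbe] at hobs
      obtain ⟨h1, h2⟩ := List.append_inj' hobs rfl
      simp only [List.cons.injEq, and_true] at h2
      rw [h2] at h1
      exact hn (fun j => y (j + 1)) (fun j => hy (j + 1))
        ⟨y 0, ⟨hy0, fun i => congrFun h2 i⟩, hy 0⟩ h1

theorem Wins.copsWin (h : Wins G m Set.univ) : CopsWin G m := by
  obtain ⟨σ, hσ⟩ := h.exists_strategy
  refine ⟨σ, fun x hx => ?_⟩
  obtain ⟨n, hn⟩ := hσ x hx (Set.mem_univ _)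
  exact ⟨n, fun y hy => hn y hy (Set.mem_univ _)⟩

/-! ### A lower bound for the localization number -/

/-- The distances from `a` to `v` and to its neighbors take at most three values, so that a probe
has at most `3 ^ m` answers on a closed neighborhood. -/
theorem exists_ne_forall_dist_eq {v : V} {N : Finset V} (hcard : 3 ^ m < N.card)
    (hN : ∀ w ∈ N, w = v ∨ G.Adj v w) (u : Fin m → V) :
    ∃ w ∈ N, ∃ w' ∈ N, w ≠ w' ∧ ∀ i, G.dist (u i) w = G.dist (u i) w' := by
  classical
  have key : ∀ w ∈ N, ∀ i, G.dist (u i) w + 1 - G.dist (u i) v < 3 ∧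
      G.dist (u i) v ≤ G.dist (u i) w + 1 := by
    intro w hw i
    rcases hN w hw with rfl | h
    · omega
    · have := h.diff_dist_adj (u := u i)
      omega
  let f : V → Fin m → Fin 3 := fun w i => Fin.ofNat 3 (G.dist (u i) w + 1 - G.dist (u i) v)
  obtain ⟨w, hw, w', hw', hne, hf⟩ := Finset.exists_ne_map_eq_of_card_lt_of_maps_to
    (s := N) (t := Finset.univ) (f := f) (by simpa using hcard) (fun _ _ => Finset.mem_univ _)
  refine ⟨w, hw, w', hw', hne, fun i => ?_⟩
  have h1 := congrArg Fin.val (congrFun hf i)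
  have h2 := key w hw i
  have h3 := key w' hw' i
  simp only [f, Fin.ofNat, Nat.mod_eq_of_lt h2.1, Nat.mod_eq_of_lt h3.1] at h1
  omega

theorem observations_congr (σ : CopStrategy V m) {x y : ℕ → V} {n : ℕ}
    (h : ∀ j < n, y j = x j) : observations G σ y n = observations G σ x n := by
  induction n with
  | zero => rfl
  | succ n ih =>
    rw [observations, observations, ih fun j hj => h j (by omega), h n (by omega)]

/-- If every closed neighborhood within `C` has more than `3 ^ m` elements, then a robber who
moves in `C` always has, at the moment of a probe, two positions to choose from that the probe does
not distinguish. -/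
theorem not_copsWin_of_card (C : Set V) (hC : C.Nonempty)
    (h : ∀ v ∈ C, ∃ N : Finset V, 3 ^ m < N.card ∧ ∀ w ∈ N, w ∈ C ∧ (w = v ∨ G.Adj v w)) :
    ¬ CopsWin G m := by
  classical
  rintro ⟨σ, hσ⟩
  have h2 : ∀ (v : C) (u : Fin m → V), ∃ w w' : C, w ≠ w' ∧ (w.1 = v.1 ∨ G.Adj v w) ∧
      (w'.1 = v.1 ∨ G.Adj v w') ∧ ∀ i, G.dist (u i) w = G.dist (u i) w' := by
    intro v u
    obtain ⟨N, hN, hN'⟩ := h v.1 v.2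
    obtain ⟨w, hw, w', hw', hne, hd⟩ := exists_ne_forall_dist_eq hN (fun w hw => (hN' w hw).2) u
    exact ⟨⟨w, (hN' w hw).1⟩, ⟨w', (hN' w' hw').1⟩, fun e => hne (congrArg Subtype.val e),
      (hN' w hw).2, (hN' w' hw').2, hd⟩
  choose p q hpq hp hq hd using h2
  -- The first component is the robber's previous position, the second what the cops have seen.
  let s : ℕ → C × List (Fin m → ℕ) := fun n => n.rec (⟨hC.some, hC.some_mem⟩, [])
    fun _ s => (p s.1 (σ s.2), (fun i => G.dist (σ s.2 i) (p s.1 (σ s.2))) :: s.2)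
  let x : ℕ → V := fun n => p (s n).1 (σ (s n).2)
  have hs : ∀ n, (s (n + 1)).1.1 = x n := fun _ => rfl
  have hobs : ∀ n, observations G σ x n = (s n).2 := by
    intro n
    induction n with
    | zero => rfl
    | succ n ih => rw [observations, ih]
  have hx : IsRobberWalk G x := fun n => hp (s (n + 1)).1 (σ (s (n + 1)).2)
  obtain ⟨n, hn⟩ := hσ x hx
  let z : V := q (s n).1 (σ (s n).2)
  let y : ℕ → V := fun j => if j < n then x j else z
  have hyx : ∀ j < n, y j = x j := fun j hj => if_pos hj
  have hyn : y n = z := if_neg (lt_irrefl n)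
  have hy : IsRobberWalk G y := by
    intro j
    rcases lt_trichotomy (j + 1) n with hj | hj | hj
    · rw [hyx _ hj, hyx j (by omega)]
      exact hx j
    · rw [hj, hyn, hyx j (by omega)]
      subst hj
      exact hq (s (j + 1)).1 (σ (s (j + 1)).2)
    · left
      simp only [y]
      rw [if_neg (by omega), if_neg (by omega)]
  have := hn y hy (by
    rw [observations, observations, observations_congr σ hyx, hyn]
    congr 1
    funext i
    rw [hobs]
    exact (hd _ _ i).symm)
  rw [hyn] at this
  exact hpq _ _ (Subtype.ext this).symm

end Game

/-! ### Distances on the cycle -/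

/-- The relation "equal or adjacent" on the cycle of length `40`. -/
def Near (p q : Fin 40) : Prop := q = p ∨ (SimpleGraph.cycleGraph 40).Adj p q

instance (p q : Fin 40) : Decidable (Near p q) := by unfold Near; infer_instance

/-- The distance of `p` to `anchor b` on the cycle of length `40`. -/
def anchorDist (b : Bool) (p : Fin 40) : ℕ :=
  min ((p : ℕ) - anchor b + (anchor b - p)) (40 - ((p : ℕ) - anchor b + (anchor b - p)))

theorem near_iff : ∀ p q : Fin 40, Near p q ↔ ((q : ℕ) = p ∨ (q : ℕ) = p + 1 ∨ (p : ℕ) = q + 1 ∨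
    ((p : ℕ) = 0 ∧ (q : ℕ) = 39) ∨ ((p : ℕ) = 39 ∧ (q : ℕ) = 0)) := by
  decide +kernel

theorem near_comm {p q : Fin 40} : Near p q ↔ Near q p := by
  rw [near_iff, near_iff]; omega

theorem near_refl (p : Fin 40) : Near p p := Or.inl rfl

theorem card_near : ∀ p : Fin 40, (Finset.univ.filter fun q => Near p q).card = 3 := by
  decide +kernel

theorem anchorDist_le (b : Bool) (p : Fin 40) : anchorDist b p ≤ 20 := by
  unfold anchorDist; omega

theorem anchorDist_anchor (b : Bool) : anchorDist b (anchor b) = 0 := by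
  simp [anchorDist]

theorem Near.anchorDist_le {p q : Fin 40} (h : Near p q) (b : Bool) :
    anchorDist b q ≤ anchorDist b p + 1 := by
  rw [near_iff] at h
  unfold anchorDist
  have := (anchor b).2
  omega

theorem exists_near_anchorDist_lt : ∀ (b : Bool) (p : Fin 40), p ≠ anchor b →
    ∃ q, Near p q ∧ anchorDist b p = anchorDist b q + 1 := by
  decide +kernel

/-- A point of the cycle is determined by its distances to the two anchors, as these are neither
equal nor antipodal. -/
theorem eq_of_anchorDist_eq {p q : Fin 40} (b : Bool) (h : anchorDist b p = anchorDist b q)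
    (h' : anchorDist (!b) p = anchorDist (!b) q) : p = q := by
  have : ∀ p q : Fin 40, anchorDist false p = anchorDist false q →
      anchorDist true p = anchorDist true q → p = q := by decide +kernel
  cases b
  · exact this p q h h'
  · exact this p q h' h

/-! ### Adjacency in `G k` -/

section Adjacency

variable {k : ℕ}

/-- The vertex at `n` steps from the satellite on the thread to `w`. The satellite itself is
`n = 0`, and from `n = 40` on it is the core vertex `w`. -/
def along (i : Fin k) (b : Bool) (w : {w : Fin k → Fin 40 // w i = anchor b}) (n : ℕ) :
    GVertex k :=
  if h0 : n = 0 then .satellite i b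
  else if h : n < 40 then .thread i b w ⟨n - 1, by omega⟩
  else .core w.1

variable {i : Fin k} {b : Bool} {w : {w : Fin k → Fin 40 // w i = anchor b}}

theorem along_zero : along i b w 0 = .satellite i b := rfl

theorem along_forty : along i b w 40 = .core w.1 := rfl

theorem along_succ (j : Fin 39) : along i b w (j + 1) = .thread i b w j := by
  have := j.2
  simp [along, this]

theorem exists_along_eq {n : ℕ} (h1 : 1 ≤ n) (h2 : n ≤ 39) :
    ∃ j : Fin 39, (j : ℕ) + 1 = n ∧ along i b w n = .thread i b w j := by
  refine ⟨⟨n - 1, by omega⟩, by simp; omega, ?_⟩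
  rw [← along_succ]
  congr 1
  simp
  omega

theorem adj_core_core {u v : Fin k → Fin 40} :
    (G k).Adj (.core u) (.core v) ↔ u ≠ v ∧ ∀ i, Near (u i) (v i) := by
  have hs : GEdge k (.core v) (.core u) ↔ GEdge k (.core u) (.core v) :=
    ⟨fun h => h.symm, fun h => h.symm⟩
  rw [G, SimpleGraph.fromRel_adj, hs, or_self]
  simp only [GEdge, strongPower, ne_eq, GVertex.core.injEq, Near]
  constructor
  · rintro ⟨h, -, h'⟩
    exact ⟨h, fun i => (h' i).imp_left Eq.symm⟩
  · rintro ⟨h, h'⟩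
    exact ⟨h, h, fun i => (h' i).imp_left Eq.symm⟩

theorem eq_or_adj_core_iff {u v : Fin k → Fin 40} :
    (v = u ∨ (G k).Adj (.core u) (.core v)) ↔ ∀ i, Near (u i) (v i) := by
  rw [adj_core_core]
  constructor
  · rintro (rfl | h)
    · exact fun i => near_refl _
    · exact h.2
  · intro h
    by_cases e : v = u
    · exact .inl e
    · exact .inr ⟨fun e' => e e'.symm, h⟩

theorem adj_along_succ {n : ℕ} (hn : n ≤ 39) :
    (G k).Adj (along i b w n) (along i b w (n + 1)) := by
  rw [G, SimpleGraph.fromRel_adj]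
  rcases Nat.eq_zero_or_pos n with rfl | h0
  · rw [along_zero, show along i b w (0 + 1) = _ from along_succ (w := w) 0]
    simp [GEdge]
  · obtain ⟨j, hj, e⟩ := exists_along_eq (w := w) h0 hn
    rw [e]
    rcases hn.eq_or_lt with rfl | h
    · rw [along_forty]
      simp [GEdge]
      omega
    · obtain ⟨j', hj', e'⟩ := exists_along_eq (w := w) (n := n + 1) (by omega) h
      rw [e']
      simp [GEdge, Fin.ext_iff]
      omega

theorem adj_satellite {y : GVertex k} (h : (G k).Adj (.satellite i b) y) :
    ∃ w, y = along i b w 1 := by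
  rw [G, SimpleGraph.fromRel_adj] at h
  rcases y with v | ⟨i', b'⟩ | ⟨i', b', w, j⟩
  · simp [GEdge] at h
  · simp [GEdge] at h
  · simp only [GEdge, or_false] at h
    obtain ⟨-, rfl, rfl, hj⟩ := h
    exact ⟨w, by rw [← along_succ, hj]⟩

theorem adj_thread {j : Fin 39} {y : GVertex k} (h : (G k).Adj (.thread i b w j) y) :
    y = along i b w j ∨ y = along i b w (j + 2) := by
  rw [G, SimpleGraph.fromRel_adj] at h
  rcases y with v | ⟨i', b'⟩ | ⟨i', b', w', j'⟩
  · simp only [GEdge, or_false] at h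
    obtain ⟨-, rfl, hj⟩ := h
    right
    rw [hj, along_forty]
  · simp only [GEdge, false_or] at h
    obtain ⟨-, rfl, rfl, hj⟩ := h
    left
    rw [hj, along_zero]
  · simp only [GEdge] at h
    obtain ⟨-, ⟨rfl, rfl, hw, hj⟩ | ⟨rfl, rfl, hw, hj⟩⟩ := h
    · obtain rfl := Subtype.ext hw
      right
      rw [← along_succ, ← hj]
    · obtain rfl := Subtype.ext hw
      left
      rw [← hj, along_succ]

theorem adj_along {n : ℕ} (h1 : 1 ≤ n) (h2 : n ≤ 39) {y : GVertex k}
    (h : (G k).Adj (along i b w n) y) :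
    y = along i b w (n - 1) ∨ y = along i b w (n + 1) := by
  obtain ⟨j, rfl, e⟩ := exists_along_eq (w := w) h1 h2
  rw [e] at h
  exact adj_thread h

theorem adj_core {v : Fin k → Fin 40} {y : GVertex k} (h : (G k).Adj (.core v) y) :
    (∃ u, y = .core u) ∨ ∃ (i : Fin k) (b : Bool) (hv : v i = anchor b),
      y = along i b ⟨v, hv⟩ 39 := by
  rw [G, SimpleGraph.fromRel_adj] at h
  rcases y with u | ⟨i', b'⟩ | ⟨i', b', ⟨w', hw'⟩, j'⟩
  · exact .inl ⟨u, rfl⟩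
  · simp [GEdge] at h
  · simp only [GEdge, false_or] at h
    obtain ⟨-, rfl, hj⟩ := h
    exact .inr ⟨i', b', hw', by rw [← along_succ, hj]⟩

/-- The core vertices that agree with `v` or differ from it by `1` in each coordinate. -/
def coreNbhd (v : Fin k → Fin 40) : Finset (Fin k → Fin 40) :=
  Fintype.piFinset fun i => Finset.univ.filter fun q => Near (v i) q

theorem mem_coreNbhd {u v : Fin k → Fin 40} : u ∈ coreNbhd v ↔ ∀ i, Near (v i) (u i) := by
  simp [coreNbhd]

theorem card_coreNbhd (v : Fin k → Fin 40) : (coreNbhd v).card = 3 ^ k := by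
  simp [coreNbhd, card_near]

end Adjacency

/-! ### The degeneracy of `G k` -/

theorem degeneracy_G {k : ℕ} (hk : 1 ≤ k) : degeneracy (G k) = 3 ^ k - 1 := by
  classical
  have h3 : 3 ^ 1 ≤ 3 ^ k := Nat.pow_le_pow_right (by norm_num) hk
  have hcore : ∀ v : Fin k → Fin 40, (((coreNbhd v).erase v).image GVertex.core).card =
      3 ^ k - 1 := by
    intro v
    rw [Finset.card_image_of_injective _ fun _ _ h => GVertex.core.inj h,
      Finset.card_erase_of_mem (mem_coreNbhd.2 fun i => near_refl _), card_coreNbhd]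
  apply le_antisymm
  · refine ciSup_le fun H => ?_
    -- A vertex of `H` whose degree in `H` is at most `3 ^ k - 1`.
    suffices h : H.verts = ∅ ∨ ∃ (v : H.verts) (N : Finset (GVertex k)), N.card ≤ 3 ^ k - 1 ∧
        ∀ u, H.Adj v u → u ∈ N by
      rcases h with h | ⟨v, N, hN, hv⟩
      · have : IsEmpty H.verts := Set.isEmpty_coe_sort.2 h
        rw [SimpleGraph.minDegree_of_subsingleton]
        exact Nat.zero_le _
      · refine (H.coe.minDegree_le_degree v).trans (le_trans ?_ hN)
        rw [SimpleGraph.Subgraph.coe_degree,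
          ← SimpleGraph.Subgraph.finset_card_neighborSet_eq_degree]
        refine Finset.card_le_card fun u hu => hv u ?_
        simpa using hu
    by_cases ht : ∃ i b w j, GVertex.thread (k := k) i b w j ∈ H.verts
    · obtain ⟨i, b, w, j, hj⟩ := ht
      refine .inr ⟨⟨_, hj⟩, {along i b w j, along i b w (j + 2)}, ?_, fun u hu => ?_⟩
      · exact Finset.card_le_two.trans (by omega)
      · simpa using adj_thread hu.adj_sub
    · push Not at ht
      rcases Set.eq_empty_or_nonempty H.verts with h | ⟨v, hv⟩
      · exact .inl h
      right
      rcases v with v | ⟨i, b⟩ | ⟨i, b, w, j⟩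
      · refine ⟨⟨_, hv⟩, _, (hcore v).le, fun u hu => ?_⟩
        rcases adj_core hu.adj_sub with ⟨u, rfl⟩ | ⟨i, b, hv, rfl⟩
        · have := adj_core_core.1 hu.adj_sub
          simpa [mem_coreNbhd] using ⟨this.1.symm, this.2⟩
        · exact absurd (H.edge_vert hu.symm) (ht i b _ ⟨38, by omega⟩)
      · refine ⟨⟨_, hv⟩, ∅, by simp, fun u hu => ?_⟩
        obtain ⟨w, rfl⟩ := adj_satellite hu.adj_sub
        exact absurd (H.edge_vert hu.symm) (ht i b w 0)
      · exact absurd hv (ht i b w j)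
  · let H : (G k).Subgraph := (⊤ : (G k).Subgraph).induce (Set.range GVertex.core)
    have : Nonempty H.verts := ⟨⟨.core fun _ => 0, Set.mem_range_self _⟩⟩
    suffices h : 3 ^ k - 1 ≤ H.coe.minDegree by
      refine le_trans (h.trans_eq ?_) (le_ciSup (Set.finite_range _).bddAbove H)
      congr!
    apply SimpleGraph.le_minDegree_of_forall_le_degree
    rintro ⟨_, v, rfl⟩
    rw [SimpleGraph.Subgraph.coe_degree, ← SimpleGraph.Subgraph.finset_card_neighborSet_eq_degree,
      ← hcore v]
    refine Finset.card_le_card fun u hu => ?_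
    simp only [Finset.mem_image, Finset.mem_erase, mem_coreNbhd] at hu
    obtain ⟨u, ⟨hne, hu⟩, rfl⟩ := hu
    simp [H, adj_core_core, hne.symm, hu]

/-! ### Distances by potentials -/

section Potential

variable {V : Type*} {G : SimpleGraph V} {f : V → ℕ} {u : V} {P : V → Prop}

/-- A function that vanishes at `u` and changes by at most `1` along edges bounds the
distance to `u` from below. -/
theorem le_dist_of_lipschitz (hu : f u = 0) (hlip : ∀ x y, G.Adj x y → f y ≤ f x + 1) {x : V}
    (hr : G.Reachable u x) : f x ≤ G.dist u x := by
  obtain ⟨p, hp⟩ := hr.exists_walk_length_eq_dist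
  rw [← hp]
  suffices h : ∀ {a b : V} (q : G.Walk a b), f b ≤ f a + q.length by
    simpa [hu] using h p
  intro a b q
  induction q with
  | nil => simp
  | cons h q ih =>
    have := hlip _ _ h
    rw [SimpleGraph.Walk.length_cons]
    omega

theorem exists_walk_of_descent
    (hdesc : ∀ x, P x → x = u ∨ ∃ y, P y ∧ G.Adj x y ∧ f x = f y + 1) {x : V} (hx : P x) :
    ∃ p : G.Walk u x, p.length ≤ f x := by
  induction h : f x using Nat.strong_induction_on generalizing x with
  | _ n ih =>
    rcases hdesc x hx with rfl | ⟨y, hy, hxy, hf⟩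
    · exact ⟨.nil, by simp⟩
    · obtain ⟨p, hp⟩ := ih (f y) (by omega) hy rfl
      exact ⟨p.concat hxy.symm, by rw [SimpleGraph.Walk.length_concat]; omega⟩

/-- A function that changes by at most `1` along edges is the distance to `u` on each set
in which it can be decreased by `1` step by step until `u` is reached. -/
theorem dist_eq_of_descent (hu : f u = 0) (hlip : ∀ x y, G.Adj x y → f y ≤ f x + 1)
    (hdesc : ∀ x, P x → x = u ∨ ∃ y, P y ∧ G.Adj x y ∧ f x = f y + 1) {x : V} (hx : P x) :
    G.dist u x = f x := by
  obtain ⟨p, hp⟩ := exists_walk_of_descent hdesc hx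
  exact le_antisymm ((SimpleGraph.dist_le p).trans hp) (le_dist_of_lipschitz hu hlip p.reachable)

end Potential

section Distances

variable {k : ℕ}

theorem G_lipschitz {f : GVertex k → ℕ}
    (h : ∀ x y, GEdge k x y → f y ≤ f x + 1 ∧ f x ≤ f y + 1) (x y : GVertex k)
    (hxy : (G k).Adj x y) : f y ≤ f x + 1 := by
  rw [G, SimpleGraph.fromRel_adj] at hxy
  rcases hxy.2 with h' | h'
  · exact (h _ _ h').1
  · exact (h _ _ h').2

/-- A lower bound for the distance to `satellite i b`. It is the exact distance on the core, on
the threads of this satellite, and on the parts of the other threads from which the way over the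
core is not longer than the way over their satellite. -/
def satPotential (i : Fin k) (b : Bool) : GVertex k → ℕ
  | .core v => 40 + anchorDist b (v i)
  | .satellite i' b' => if i' = i ∧ b' = b then 0 else 80
  | .thread i' b' w j =>
      if i' = i ∧ b' = b then j + 1 else min (79 - j + anchorDist b (w.1 i)) (81 + j)

theorem satPotential_lipschitz (i : Fin k) (b : Bool) (x y : GVertex k) (h : (G k).Adj x y) :
    satPotential i b y ≤ satPotential i b x + 1 := by
  refine G_lipschitz ?_ x y h
  rintro (u | ⟨i₁, b₁⟩ | ⟨i₁, b₁, w₁, j₁⟩) (v | ⟨i₂, b₂⟩ | ⟨i₂, b₂, w₂, j₂⟩) h <;>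
    simp only [GEdge] at h
  · have h' := (adj_core_core.1 (by rw [G, SimpleGraph.fromRel_adj]; exact
      ⟨by simpa using h.1, .inl h⟩)).2 i
    have h1 := h'.anchorDist_le b
    have h2 := (near_comm.1 h').anchorDist_le b
    simp only [satPotential]
    omega
  · obtain ⟨rfl, rfl, hj⟩ := h
    simp only [satPotential]
    split_ifs <;> omega
  · obtain ⟨rfl, hj⟩ := h
    have hw := w₁.2
    simp only [satPotential]
    split_ifs with hi
    · obtain ⟨rfl, rfl⟩ := hi
      rw [hw, anchorDist_anchor]
      omega
    · have := anchorDist_le b (w₁.1 i)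
      omega
  · obtain ⟨rfl, rfl, hw, hj⟩ := h
    simp only [satPotential, hw]
    split_ifs <;> omega

theorem satPotential_along_self (i : Fin k) (b : Bool) (w) {n : ℕ} (hn : n ≤ 40) :
    satPotential i b (along i b w n) = n := by
  rcases Nat.eq_zero_or_pos n with rfl | h0
  · simp [along_zero, satPotential]
  rcases hn.eq_or_lt with rfl | hn
  · simp [along_forty, satPotential, w.2, anchorDist_anchor]
  · obtain ⟨j, rfl, e⟩ := exists_along_eq (w := w) h0 (by omega)
    simp [e, satPotential]

theorem satPotential_along_of_ne {i i' : Fin k} {b b' : Bool} (h : ¬ (i' = i ∧ b' = b)) (w) {n : ℕ}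
    (hn : 10 ≤ n) (hn' : n ≤ 40) :
    satPotential i b (along i' b' w n) = 80 - n + anchorDist b (w.1 i) := by
  rcases hn'.eq_or_lt with rfl | hn'
  · simp [along_forty, satPotential]
  · obtain ⟨j, rfl, e⟩ := exists_along_eq (w := w) (by omega : 1 ≤ n) (by omega)
    have := anchorDist_le b (w.1 i)
    simp only [e, satPotential, h, if_false]
    omega

/-- The vertices on which `satPotential i b` is shown to be the exact distance. -/
inductive SatExact (i : Fin k) (b : Bool) : GVertex k → Prop
  | core (v : Fin k → Fin 40) : SatExact i b (.core v)
  | own (w) (n : ℕ) (hn : n ≤ 40) : SatExact i b (along i b w n)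
  | other (i' : Fin k) (b' : Bool) (h : ¬ (i' = i ∧ b' = b)) (w) (n : ℕ) (hn : 10 ≤ n)
      (hn' : n ≤ 40) : SatExact i b (along i' b' w n)

theorem satPotential_descent (i : Fin k) (b : Bool) (x : GVertex k) (hx : SatExact i b x) :
    x = .satellite i b ∨ ∃ y, SatExact i b y ∧ (G k).Adj x y ∧
      satPotential i b x = satPotential i b y + 1 := by
  have hown : ∀ w (n : ℕ), n ≤ 40 → along i b w n = .satellite i b ∨ ∃ y, SatExact i b y ∧
      (G k).Adj (along i b w n) y ∧ satPotential i b (along i b w n) = satPotential i b y + 1 := by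
    intro w n hn
    rcases n with _ | n
    · exact .inl along_zero
    · refine .inr ⟨along i b w n, .own w n (by omega), (adj_along_succ (by omega)).symm, ?_⟩
      rw [satPotential_along_self _ _ _ hn, satPotential_along_self _ _ _ (by omega)]
  have hcore : ∀ v, ∃ y, SatExact i b y ∧ (G k).Adj (.core v) y ∧
      satPotential i b (.core v) = satPotential i b y + 1 := by
    intro v
    by_cases hv : v i = anchor b
    · refine ⟨along i b ⟨v, hv⟩ 39, .own _ _ (by omega),
        (adj_along_succ (w := ⟨v, hv⟩) (n := 39) le_rfl).symm, ?_⟩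
      rw [satPotential_along_self _ _ _ (by omega)]
      simp [satPotential, hv, anchorDist_anchor]
    · obtain ⟨q, hq, hd⟩ := exists_near_anchorDist_lt b (v i) hv
      refine ⟨.core (Function.update v i q), .core _, adj_core_core.2 ⟨?_, ?_⟩, ?_⟩
      · intro e
        have := congrFun e i
        rw [Function.update_self] at this
        rw [← this] at hd
        omega
      · intro j
        by_cases hj : j = i
        · subst hj
          simpa using hq
        · simpa [hj] using near_refl _
      · simp [satPotential, hd]
        omega
  rcases hx with v | ⟨w, n, hn⟩ | ⟨i', b', h, w, n, hn, hn'⟩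
  · exact .inr (hcore v)
  · exact hown w n hn
  · right
    rcases hn'.eq_or_lt with rfl | hn'
    · exact hcore w.1
    · refine ⟨along i' b' w (n + 1), .other _ _ h _ _ (by omega) hn', adj_along_succ (by omega), ?_⟩
      rw [satPotential_along_of_ne h _ hn (by omega),
        satPotential_along_of_ne h _ (by omega) hn']
      omega

theorem dist_satellite_of_satExact {i : Fin k} {b : Bool} {x : GVertex k} (hx : SatExact i b x) :
    (G k).dist (.satellite i b) x = satPotential i b x :=
  dist_eq_of_descent (by simp [satPotential]) (satPotential_lipschitz i b)
    (satPotential_descent i b) hx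

theorem dist_satellite_core (i : Fin k) (b : Bool) (v : Fin k → Fin 40) :
    (G k).dist (.satellite i b) (.core v) = 40 + anchorDist b (v i) :=
  dist_satellite_of_satExact (.core v)

theorem dist_satellite_along_self (i : Fin k) (b : Bool) (w) {n : ℕ} (hn : n ≤ 40) :
    (G k).dist (.satellite i b) (along i b w n) = n := by
  rw [dist_satellite_of_satExact (.own w n hn), satPotential_along_self _ _ _ hn]

/-- From `n = 10` on, the way over the core is a shortest one from a thread to another satellite. -/
theorem dist_satellite_along_of_ne {i i' : Fin k} {b b' : Bool} (h : ¬ (i' = i ∧ b' = b)) (w)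
    {n : ℕ} (hn : 10 ≤ n) (hn' : n ≤ 40) :
    (G k).dist (.satellite i b) (along i' b' w n) = 80 - n + anchorDist b (w.1 i) := by
  rw [dist_satellite_of_satExact (.other _ _ h w n hn hn'), satPotential_along_of_ne h _ hn hn']

theorem reachable_satellite_core (i : Fin k) (b : Bool) (v : Fin k → Fin 40) :
    (G k).Reachable (.satellite i b) (.core v) := by
  obtain ⟨p, -⟩ := exists_walk_of_descent (satPotential_descent i b) (.core v)
  exact p.reachable

theorem exists_along (x : GVertex k) :
    (∃ v, x = .core v) ∨ ∃ i b w n, n ≤ 39 ∧ x = along i b w n := by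
  rcases x with v | ⟨i, b⟩ | ⟨i, b, w, j⟩
  · exact .inl ⟨v, rfl⟩
  · exact .inr ⟨i, b, ⟨fun _ => anchor b, rfl⟩, 0, by omega, rfl⟩
  · exact .inr ⟨i, b, w, j + 1, by omega, (along_succ j).symm⟩

theorem reachable_core_along (i : Fin k) (b : Bool) (w) {n : ℕ} (hn : n ≤ 40) :
    (G k).Reachable (.core w.1) (along i b w n) := by
  obtain ⟨m, rfl⟩ : ∃ m, n = 40 - m := ⟨40 - n, by omega⟩
  induction m with
  | zero => exact .refl _
  | succ m ih =>
    rcases le_or_gt 40 m with h | h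
    · rw [show 40 - (m + 1) = 40 - m by omega]
      exact ih (by omega)
    · refine (ih (by omega)).trans ?_
      rw [show 40 - m = 40 - (m + 1) + 1 by omega]
      exact (adj_along_succ (by omega)).symm.reachable

theorem reachable_satellite (i : Fin k) (b : Bool) (x : GVertex k) :
    (G k).Reachable (.satellite i b) x := by
  rcases exists_along x with ⟨v, rfl⟩ | ⟨i', b', w, n, hn, rfl⟩
  · exact reachable_satellite_core i b v
  · exact (reachable_satellite_core i b w.1).trans (reachable_core_along i' b' w (by omega))

/-- Distances below `40` from a satellite occur only on its own threads. -/
theorem exists_along_of_dist_lt {i : Fin k} {b : Bool} {x : GVertex k}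
    (h : (G k).dist (.satellite i b) x < 40) :
    ∃ w, x = along i b w ((G k).dist (.satellite i b) x) := by
  have hle := le_dist_of_lipschitz (by simp [satPotential]) (satPotential_lipschitz i b)
    (reachable_satellite i b x)
  rcases x with v | ⟨i', b'⟩ | ⟨i', b', w, j⟩
  · simp only [satPotential] at hle
    omega
  · simp only [satPotential] at hle
    split_ifs at hle with hi
    · obtain ⟨rfl, rfl⟩ := hi
      exact ⟨⟨fun _ => anchor b', rfl⟩, by rw [SimpleGraph.dist_self]; rfl⟩
    · omega
  · simp only [satPotential] at hle
    split_ifs at hle with hi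
    · obtain ⟨rfl, rfl⟩ := hi
      refine ⟨w, ?_⟩
      rw [← along_succ, dist_satellite_along_self _ _ _ (by omega)]
    · omega

/-- A lower bound for the distance to the core vertex `u`, exact on the threads that end in `u`. -/
def corePotential (u : Fin k → Fin 40) : GVertex k → ℕ
  | .core v => if v = u then 0 else 1
  | .satellite _ _ => 40
  | .thread _ _ w j => if w.1 = u then 39 - j else 40 - j

theorem corePotential_lipschitz (u : Fin k → Fin 40) (x y : GVertex k) (h : (G k).Adj x y) :
    corePotential u y ≤ corePotential u x + 1 := by
  refine G_lipschitz ?_ x y h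
  rintro (u | ⟨i₁, b₁⟩ | ⟨i₁, b₁, w₁, j₁⟩) (v | ⟨i₂, b₂⟩ | ⟨i₂, b₂, w₂, j₂⟩) h <;>
    simp only [GEdge] at h
  · simp only [corePotential]
    split_ifs <;> omega
  · obtain ⟨rfl, rfl, hj⟩ := h
    simp only [corePotential]
    split_ifs <;> omega
  · obtain ⟨rfl, hj⟩ := h
    simp only [corePotential]
    split_ifs <;> omega
  · obtain ⟨rfl, rfl, hw, hj⟩ := h
    simp only [corePotential, hw]
    split_ifs <;> omega

/-- A probe at a core vertex `u` tells whether a thread on which the robber is known to be at `n`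
steps from its satellite ends in `u`. -/
theorem dist_core_along_eq_iff {u : Fin k → Fin 40} {i : Fin k} {b : Bool} (w) {n : ℕ}
    (h1 : 1 ≤ n) (h2 : n ≤ 39) :
    (G k).dist (.core u) (along i b w n) = 40 - n ↔ w.1 = u := by
  constructor
  · intro h
    by_contra hne
    have hle := le_dist_of_lipschitz (f := corePotential u) (u := .core u) (by simp [corePotential])
      (corePotential_lipschitz u) (((reachable_satellite i b _).symm.trans
        (reachable_satellite i b (along i b w n))))
    rw [h] at hle
    obtain ⟨j, rfl, e⟩ := exists_along_eq (w := w) h1 h2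
    simp only [e, corePotential, hne, if_false] at hle
    omega
  · rintro rfl
    have hpot : ∀ n, 1 ≤ n → n ≤ 40 → corePotential w.1 (along i b w n) = 40 - n := by
      intro n h1 h2
      rcases h2.eq_or_lt with rfl | h2
      · simp [along_forty, corePotential]
      · obtain ⟨j, rfl, e⟩ := exists_along_eq (w := w) h1 (by omega)
        simp only [e, corePotential, if_true]
        omega
    rw [← hpot n h1 (by omega)]
    refine dist_eq_of_descent (P := fun x => ∃ n, 1 ≤ n ∧ n ≤ 40 ∧ x = along i b w n)
      (by simp [corePotential]) (corePotential_lipschitz w.1) ?_ ⟨n, h1, by omega, rfl⟩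
    rintro _ ⟨n, h1, h2, rfl⟩
    rcases h2.eq_or_lt with rfl | h2
    · exact .inl rfl
    · refine .inr ⟨_, ⟨n + 1, by omega, by omega, rfl⟩, adj_along_succ (by omega), ?_⟩
      rw [hpot n h1 (by omega), hpot (n + 1) (by omega) (by omega)]
      omega

end Distances

/-! ### Robbers on a known thread bundle -/

section Threads

variable {k : ℕ}

/-- The probe of one satellite for each coordinate: that of `anchor (t i)` for coordinate `i`. -/
def satProbe (t : Fin k → Bool) : Fin k → GVertex k := fun i => .satellite i (t i)

theorem exists_along_of_move {i : Fin k} {b : Bool} {w} {n : ℕ} (h1 : 1 ≤ n) (h2 : n ≤ 39)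
    {y : GVertex k} (h : y = along i b w n ∨ (G k).Adj (along i b w n) y) :
    ∃ n', n ≤ n' + 1 ∧ n' ≤ n + 1 ∧ y = along i b w n' := by
  rcases h with rfl | h
  · exact ⟨n, by omega, by omega, rfl⟩
  · rcases adj_along h1 h2 h with rfl | rfl
    · exact ⟨n - 1, by omega, by omega, rfl⟩
    · exact ⟨n + 1, by omega, by omega, rfl⟩

/-- A robber at a known height on a thread of a known satellite is located by the next probe, if
one of the two anchor distances is known for each of the other coordinates of the end of the
thread: the probe of the other anchor resolves the ambiguity. -/
theorem winsAfterProbe_of_anchorDist {i : Fin k} {b : Bool} {n : ℕ} (h1 : 11 ≤ n) (h2 : n ≤ 39)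
    (t : Fin k → Bool) (e : Fin k → ℕ) {S : Set (GVertex k)}
    (hS : ∀ x ∈ S, ∃ w, x = along i b w n ∧ ∀ j ≠ i, anchorDist (t j) (w.1 j) = e j) :
    WinsAfterProbe (G k) k S := by
  refine .of_wins (.probe _ (satProbe fun j => if j = i then b else !t j) fun d hd => absurd ?_ hd)
  have key : ∀ x ∈ consistent (G k) (afterMove (G k) S)
      (satProbe fun j => if j = i then b else !t j) d, d i ≤ 40 ∧ ∃ w, x = along i b w (d i) ∧
        ∀ j ≠ i, anchorDist (t j) (w.1 j) = e j ∧
          80 - d i + anchorDist (!t j) (w.1 j) = d j := by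
    rintro x ⟨⟨y, hy, hyx⟩, hd⟩
    obtain ⟨w, rfl, hw⟩ := hS y hy
    obtain ⟨n', hn1, hn2, rfl⟩ := exists_along_of_move (by omega) h2 hyx
    have hi := hd i
    simp only [satProbe, if_true, dist_satellite_along_self i b w (show n' ≤ 40 by omega)] at hi
    subst hi
    refine ⟨by omega, w, rfl, fun j hj => ⟨hw j hj, ?_⟩⟩
    have hj' := hd j
    simp only [satProbe, hj, if_false] at hj'
    rwa [dist_satellite_along_of_ne (fun h => hj h.1.symm) w (by omega) (by omega)] at hj'
  intro x hx y hy
  obtain ⟨hd, w, rfl, hw⟩ := key x hx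
  obtain ⟨-, w', rfl, hw'⟩ := key y hy
  suffices h : w = w' by rw [h]
  ext j : 2
  by_cases hj : j = i
  · subst hj
    rw [w.2, w'.2]
  · refine eq_of_anchorDist_eq (t j) ((hw j hj).1.trans (hw' j hj).1.symm) ?_
    have h3 := (hw j hj).2
    have h4 := (hw' j hj).2
    omega

/-- A robber at a known height on a thread of a known satellite is located at the latest when he
leaves the thread for the core. One cop stays at the satellite, so that he cannot pass through
it. While he is near the satellite, the anchor distances of the end of his thread are out of
sight, and the others try the possible ends one by one; once he is farther away, two probes of
all anchors suffice, and he cannot be in the core before the second one. -/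
theorem winsAfterProbe_of_mem_thread {i : Fin k} {b : Bool}
    (W : Finset {w : Fin k → Fin 40 // w i = anchor b}) {n : ℕ} (h1 : 1 ≤ n) (h2 : n ≤ 38)
    {S : Set (GVertex k)} (hS : ∀ x ∈ S, ∃ w ∈ W, x = along i b w n) :
    WinsAfterProbe (G k) k S := by
  classical
  induction hW : W.card generalizing W n S with
  | zero =>
    refine WinsAfterProbe.of_subsingleton fun x hx => ?_
    obtain ⟨w, hw, -⟩ := hS x hx
    rw [Finset.card_eq_zero.1 hW] at hw
    exact absurd hw (Finset.notMem_empty w)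
  | succ c ih =>
  -- From `n = 12` on, the robber is at least `10` steps from the satellite at the next two probes,
  -- so that these see the anchor distances of the end of the thread.
  rcases le_or_gt 12 n with h3 | h3
  · refine .of_wins (.probe _ (satProbe fun j => if j = i then b else false) fun d => ?_)
    by_cases hdi : 11 ≤ d i ∧ d i ≤ 39
    · refine winsAfterProbe_of_anchorDist (i := i) (b := b) hdi.1 hdi.2 (fun _ => false)
        (fun j => d j - (80 - d i)) ?_
      rintro x ⟨⟨y, hy, hyx⟩, hd⟩
      obtain ⟨w, hw, rfl⟩ := hS y hy
      obtain ⟨n', hn1, hn2, rfl⟩ := exists_along_of_move h1 (by omega) hyx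
      have hi := hd i
      simp only [satProbe, if_true, dist_satellite_along_self i b w (show n' ≤ 40 by omega)] at hi
      subst hi
      refine ⟨w, rfl, fun j hj => ?_⟩
      have hj' := hd j
      simp only [satProbe, hj, if_false] at hj'
      rw [dist_satellite_along_of_ne (fun h => hj h.1.symm) w (by omega) (by omega)] at hj'
      omega
    · refine WinsAfterProbe.of_subsingleton ?_
      rintro x ⟨⟨y, hy, hyx⟩, hd⟩
      obtain ⟨w, hw, rfl⟩ := hS y hy
      obtain ⟨n', hn1, hn2, rfl⟩ := exists_along_of_move h1 (by omega) hyx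
      have hi := hd i
      simp only [satProbe, if_true, dist_satellite_along_self i b w (show n' ≤ 40 by omega)] at hi
      omega
  · by_cases hk : ∃ j : Fin k, j ≠ i
    · obtain ⟨j, hj⟩ := hk
      obtain ⟨w₀, hw₀⟩ : W.Nonempty := Finset.card_pos.1 (by omega)
      refine .of_wins (.probe _
        (fun l => if l = i then .satellite i b else .core w₀.1) fun d => ?_)
      have key : ∀ x ∈ consistent (G k) (afterMove (G k) S)
          (fun l => if l = i then .satellite i b else .core w₀.1) d,
          d i ≤ 38 ∧ ∃ w ∈ W, x = along i b w (d i) ∧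
            (1 ≤ d i → (d j = 40 - d i ↔ w = w₀)) := by
        rintro x ⟨⟨y, hy, hyx⟩, hd⟩
        obtain ⟨w, hw, rfl⟩ := hS y hy
        obtain ⟨n', hn1, hn2, rfl⟩ := exists_along_of_move h1 (by omega) hyx
        have hi := hd i
        simp only [if_true, dist_satellite_along_self i b w (show n' ≤ 40 by omega)] at hi
        subst hi
        refine ⟨by omega, w, hw, rfl, fun h0 => ?_⟩
        have hj' := hd j
        simp only [hj, if_false] at hj'
        rw [← hj', dist_core_along_eq_iff w h0 (by omega), Subtype.ext_iff]
      rcases Nat.eq_zero_or_pos (d i) with h0 | h0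
      · refine WinsAfterProbe.of_subsingleton fun x hx y hy => ?_
        obtain ⟨-, w, -, rfl, -⟩ := key x hx
        obtain ⟨-, w', -, rfl, -⟩ := key y hy
        rw [h0, along_zero, along_zero]
      -- The cop at `w₀` sees whether the thread ends in `w₀`; if not, `w₀` is discarded.
      by_cases h4 : d j = 40 - d i
      · refine WinsAfterProbe.of_subsingleton fun x hx y hy => ?_
        obtain ⟨-, w, -, rfl, hw⟩ := key x hx
        obtain ⟨-, w', -, rfl, hw'⟩ := key y hy
        rw [(hw h0).1 h4, (hw' h0).1 h4]
      by_cases h5 : d i ≤ 38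
      · refine ih (W.erase w₀) h0 h5 (fun x hx => ?_) (by rw [Finset.card_erase_of_mem hw₀]; omega)
        obtain ⟨-, w, hwW, hx, hw⟩ := key x hx
        exact ⟨w, Finset.mem_erase.2 ⟨fun h => h4 ((hw h0).2 h), hwW⟩, hx⟩
      · exact WinsAfterProbe.of_subsingleton fun x hx => absurd (key x hx).1 h5
    · -- There is only one coordinate, hence only one thread.
      push Not at hk
      refine WinsAfterProbe.of_subsingleton fun x hx y hy => ?_
      obtain ⟨w, -, rfl⟩ := hS x hx
      obtain ⟨w', -, rfl⟩ := hS y hy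
      suffices h : w = w' by rw [h]
      ext j : 2
      rw [hk j, w.2, w'.2]

/-- If a probe of one satellite for each coordinate shows the robber at less than `40` steps from
one of them, then the cops win. -/
theorem winsAfterProbe_of_lt (S : Set (GVertex k)) (t : Fin k → Bool) (d : Fin k → ℕ) {i : Fin k}
    (hi : d i < 40) : WinsAfterProbe (G k) k (consistent (G k) S (satProbe t) d) := by
  have key : ∀ x ∈ consistent (G k) S (satProbe t) d, ∃ w, x = along i (t i) w (d i) := by
    rintro x ⟨-, hd⟩
    have h : (G k).dist (.satellite i (t i)) x = d i := hd i
    obtain ⟨w, hw⟩ := exists_along_of_dist_lt (h.trans_lt hi)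
    exact ⟨w, h ▸ hw⟩
  rcases Nat.eq_zero_or_pos (d i) with h0 | h0
  · refine WinsAfterProbe.of_subsingleton fun x hx y hy => ?_
    obtain ⟨w, rfl⟩ := key x hx
    obtain ⟨w', rfl⟩ := key y hy
    rw [h0, along_zero, along_zero]
  -- From `d i = 39` the robber may reach the core with his next move; but then the present probe
  -- has also shown one anchor distance of each coordinate of the end of the thread.
  rcases le_or_gt (d i) 38 with h1 | h1
  · refine winsAfterProbe_of_mem_thread (i := i) (b := t i) Finset.univ h0 h1 fun x hx => ?_
    obtain ⟨w, hw⟩ := key x hx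
    exact ⟨w, Finset.mem_univ _, hw⟩
  · refine winsAfterProbe_of_anchorDist (i := i) (b := t i) (n := d i) (by omega) (by omega) t
      (fun j => d j - (80 - d i)) fun x hx => ?_
    obtain ⟨w, rfl⟩ := key x hx
    refine ⟨w, rfl, fun j hj => ?_⟩
    have hj' : (G k).dist (.satellite j (t j)) (along i (t i) w (d i)) = d j := hx.2 j
    rw [dist_satellite_along_of_ne (fun h => hj h.1.symm) w (by omega) (by omega)] at hj'
    omega

/-- To win with a probe of one satellite for each coordinate, only the answers that do not
show the robber on one of their threads need to be considered. -/
theorem wins_of_satProbe {S : Set (GVertex k)} (t : Fin k → Bool)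
    (h : ∀ d, (∀ i, 40 ≤ d i) →
      WinsAfterProbe (G k) k (consistent (G k) S (satProbe t) d)) : Wins (G k) k S := by
  refine .probe S (satProbe t) fun d => ?_
  by_cases hd : ∀ i, 40 ≤ d i
  · exact h d hd
  · push Not at hd
    obtain ⟨i, hi⟩ := hd
    exact winsAfterProbe_of_lt S t d hi

end Threads

/-! ### Robbers in the core and next to it -/

section NearCore

variable {k : ℕ}

/-- The core vertices with `i`-th coordinate in `A i` for all `i`, and the last thread vertices
before a core vertex with coordinates in `B i`, on threads of the satellites `τ`. -/
def nearCore (A B : Fin k → Set (Fin 40)) (τ : Fin k → Bool) : Set (GVertex k) :=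
  {x | (∃ v, x = .core v ∧ ∀ i, v i ∈ A i) ∨
    ∃ i w, x = along i (τ i) w 39 ∧ ∀ j, w.1 j ∈ B j}

/-- The core coordinates that can occur after a move from `nearCore`. -/
def spread (A B : Set (Fin 40)) : Set (Fin 40) :=
  {q | q ∈ B ∨ ∃ p ∈ A, Near p q}

/-- A probe of the satellites `t` that include those on whose threads the robber can be shows him,
or he is in the core or has just entered a thread of one of the other satellites. -/
theorem cases_of_mem_consistent {A B : Fin k → Set (Fin 40)} {τ t : Fin k → Bool}
    (ht : ∀ i, anchor (τ i) ∈ B i → t i = τ i) {d : Fin k → ℕ} (hd : ∀ i, 40 ≤ d i)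
    {x : GVertex k}
    (hx : x ∈ consistent (G k) (afterMove (G k) (nearCore A B τ)) (satProbe t) d) :
    (∃ v, x = .core v ∧ ∀ i, v i ∈ spread (A i) (B i) ∧ 40 + anchorDist (t i) (v i) = d i) ∨
      ∃ i w, x = along i (!t i) w 39 ∧
        ∀ j, w.1 j ∈ A j ∧ 41 + anchorDist (t j) (w.1 j) = d j := by
  obtain ⟨⟨y, ⟨v, rfl, hv⟩ | ⟨i, w, rfl, hw⟩, hyx⟩, hdx⟩ := hx
  · have hdx' : ∀ j, (G k).dist (.satellite j (t j)) x = d j := hdx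
    by_cases hc : ∃ u, x = .core u
    · obtain ⟨u, rfl⟩ := hc
      have hn := eq_or_adj_core_iff.1 (hyx.imp_left fun h => GVertex.core.inj h)
      refine .inl ⟨u, rfl, fun i => ⟨.inr ⟨v i, hv i, hn i⟩, ?_⟩⟩
      rw [← hdx' i, dist_satellite_core]
    · rcases adj_core (hyx.resolve_left fun h => hc ⟨v, h⟩) with h | ⟨i, b, hb, rfl⟩
      · exact absurd h hc
      right
      have hb' : b = !t i := by
        by_contra hne
        obtain rfl : b = t i := by simpa using hne
        have h1 := hdx' i
        rw [dist_satellite_along_self _ _ _ (by omega)] at h1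
        have := hd i
        omega
      subst hb'
      refine ⟨i, _, rfl, fun j => ⟨hv j, ?_⟩⟩
      rw [← hdx' j, dist_satellite_along_of_ne _ _ (by omega) (by omega)]
      rintro ⟨rfl, h⟩
      simp at h
  · have hti : t i = τ i := ht i (w.2 ▸ hw i)
    obtain ⟨n, hn1, hn2, rfl⟩ := exists_along_of_move (by omega) (by omega) hyx
    have hi : (G k).dist (.satellite i (t i)) (along i (τ i) w n) = d i := hdx i
    rw [hti, dist_satellite_along_self _ _ _ (by omega)] at hi
    obtain rfl : n = 40 := by
      have := hd i
      omega
    refine .inl ⟨w.1, rfl, fun j => ⟨.inl (hw j), ?_⟩⟩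
    rw [← hdx j]
    exact (dist_satellite_core j (t j) w.1).symm

/-- If the probe of the satellites `t` determines the coordinates of a robber in the core, then he
remains ambiguous only if he is possibly at the end of a thread to `w`. All distances
being greater by `1` there, the only alternative in the core is the vertex `v` whose coordinates are
those of `w` shifted by `1` away from the anchors `t`. -/
theorem wins_afterMove_nearCore {A B : Fin k → Set (Fin 40)} {τ t : Fin k → Bool}
    (ht : ∀ i, anchor (τ i) ∈ B i → t i = τ i)
    (hinj : ∀ i, Set.InjOn (anchorDist (t i)) (spread (A i) (B i)))
    (hnext : ∀ w : Fin k → Fin 40, (∀ i, w i ∈ A i) → (∃ i, w i = anchor (!t i)) →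
      ∃ v : Fin k → Fin 40,
        (∀ i, ∀ q ∈ spread (A i) (B i), anchorDist (t i) q = anchorDist (t i) (w i) + 1 →
          q = v i) ∧
        WinsAfterProbe (G k) k
          (nearCore (fun i => {v i}) (fun i => {w i}) fun i => !t i)) :
    Wins (G k) k (afterMove (G k) (nearCore A B τ)) := by
  refine wins_of_satProbe t fun d hd => ?_
  by_cases hth : ∃ i w, along i (!t i) w 39 ∈
      consistent (G k) (afterMove (G k) (nearCore A B τ)) (satProbe t) d ∧
        ∀ j, w.1 j ∈ A j ∧ 41 + anchorDist (t j) (w.1 j) = d j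
  · obtain ⟨i, w, -, hw⟩ := hth
    obtain ⟨v, hv, hwin⟩ := hnext w.1 (fun j => (hw j).1) ⟨i, w.2⟩
    refine hwin.mono fun x hx => ?_
    rcases cases_of_mem_consistent ht hd hx with ⟨u, rfl, hu⟩ | ⟨i', w', rfl, hw'⟩
    · refine .inl ⟨u, rfl, fun j => hv j _ (hu j).1 ?_⟩
      have h1 := (hu j).2
      have h2 := (hw j).2
      omega
    · refine .inr ⟨i', w', rfl, fun j => hinj j (.inr ⟨_, (hw' j).1, near_refl _⟩)
        (.inr ⟨_, (hw j).1, near_refl _⟩) ?_⟩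
      have h1 := (hw' j).2
      have h2 := (hw j).2
      omega
  · refine .of_subsingleton fun x hx y hy => ?_
    rcases cases_of_mem_consistent ht hd hx with ⟨u, rfl, hu⟩ | ⟨i', w', rfl, hw'⟩
    · rcases cases_of_mem_consistent ht hd hy with ⟨u', rfl, hu'⟩ | ⟨i', w', rfl, hw'⟩
      · congr 1
        funext j
        refine hinj j (hu j).1 (hu' j).1 ?_
        have h1 := (hu j).2
        have h2 := (hu' j).2
        omega
      · exact absurd ⟨i', w', hy, hw'⟩ hth
    · exact absurd ⟨i', w', hx, hw'⟩ hth

end NearCore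

/-! ### The choice of the satellites, coordinate by coordinate -/

/-- The neighbor of `p` on the cycle that is farther from `anchor b` than `p`, if there is one. -/
def awayFrom (b : Bool) (p : Fin 40) : Fin 40 :=
  if anchorDist b (p + 1) = anchorDist b p + 1 then p + 1 else p - 1

/-- The choice of the anchor when the coordinate is `v` on the core vertex and `w` at the end of a
thread of the satellite `τ`. A robber on that thread has to be seen; otherwise the chosen anchor is
neither `v` nor antipodal to `v`. -/
def nextAnchor (τ : Bool) (w v : Fin 40) : Bool :=
  if w = anchor τ then τ else decide (v = 0 ∨ v = 20)

/-- A bound for the number of rounds until a coordinate that moves away from the chosen anchor in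
each round is in `{11, …, 39}`, which it does not leave. It is positive at both anchors. -/
def roundsLeft (v : Fin 40) : ℕ :=
  if v = 0 then 1 else 11 - v

/-- A pair of consecutive values `w`, `v` of a coordinate with at most `N` rounds left. The step
from `10` to `9`, which `nextAnchor` never enforces, would lead back to `10`. -/
def Settled (N : ℕ) (w v : Fin 40) : Prop :=
  Near w v ∧ roundsLeft v ≤ N ∧ w ≠ v ∧ ¬ (w = 10 ∧ v = 9)

theorem anchorDist_nextAnchor_injOn : ∀ (τ : Bool) (w v : Fin 40), Near w v → w ≠ v →
    ¬ (w = 10 ∧ v = 9) → ∀ p, Near v p → ∀ q, Near v q →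
      anchorDist (nextAnchor τ w v) p = anchorDist (nextAnchor τ w v) q → p = q := by
  decide +kernel

theorem eq_awayFrom_nextAnchor : ∀ (τ : Bool) (w v : Fin 40), Near w v → w ≠ v →
    ¬ (w = 10 ∧ v = 9) → ∀ q, Near v q →
      anchorDist (nextAnchor τ w v) q = anchorDist (nextAnchor τ w v) v + 1 →
        q = awayFrom (nextAnchor τ w v) v := by
  decide +kernel

theorem roundsLeft_awayFrom : ∀ (τ : Bool) (w v : Fin 40), Near w v → w ≠ v →
    ¬ (w = 10 ∧ v = 9) → Near v (awayFrom (nextAnchor τ w v) v) ∧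
      roundsLeft (awayFrom (nextAnchor τ w v) v) ≤ roundsLeft v - 1 ∧
      v ≠ awayFrom (nextAnchor τ w v) v ∧ ¬ (v = 10 ∧ awayFrom (nextAnchor τ w v) v = 9) := by
  decide +kernel

theorem Settled.next {N : ℕ} {w v : Fin 40} (h : Settled (N + 1) w v) (τ : Bool) :
    Settled N v (awayFrom (nextAnchor τ w v) v) := by
  obtain ⟨h1, h2, h3, h4⟩ := roundsLeft_awayFrom τ w v h.1 h.2.2.1 h.2.2.2
  have := h.2.1
  exact ⟨h1, by omega, h3, h4⟩

theorem roundsLeft_anchor : ∀ b, 0 < roundsLeft (anchor b) := by decide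

theorem near_of_mem_spread {w v q : Fin 40} (h : Near w v) (hq : q ∈ spread {v} {w}) :
    Near v q := by
  rcases hq with rfl | ⟨p, rfl, hq⟩
  · exact near_comm.1 h
  · exact hq

/-- The robber is known to be at the core vertex `v` or at the end of a thread to `w`. As long as he
evades, all coordinates move away from the chosen anchors, until none of them is an anchor
and he cannot enter a thread any more. -/
theorem winsAfterProbe_of_settled {k : ℕ} (N : ℕ) {w v : Fin k → Fin 40} (τ : Fin k → Bool)
    (h : ∀ i, Settled N (w i) (v i)) :
    WinsAfterProbe (G k) k (nearCore (fun i => {v i}) (fun i => {w i}) τ) := by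
  induction N generalizing w v τ with
  | zero =>
    refine .of_wins (wins_afterMove_nearCore (t := fun i => nextAnchor (τ i) (w i) (v i))
      (fun i hi => if_pos (Eq.symm hi)) (fun i p hp q hq => ?_) fun u hu ⟨i, hi⟩ => ?_)
    · exact anchorDist_nextAnchor_injOn _ _ _ (h i).1 (h i).2.2.1 (h i).2.2.2 p
        (near_of_mem_spread (h i).1 hp) q (near_of_mem_spread (h i).1 hq)
    · have h1 := roundsLeft_anchor (!nextAnchor (τ i) (w i) (v i))
      rw [← hi, show u i = v i from hu i] at h1
      have := (h i).2.1
      omega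
  | succ N ih =>
    refine .of_wins (wins_afterMove_nearCore (t := fun i => nextAnchor (τ i) (w i) (v i))
      (fun i hi => if_pos (Eq.symm hi)) (fun i p hp q hq => ?_) fun u hu _ => ?_)
    · exact anchorDist_nextAnchor_injOn _ _ _ (h i).1 (h i).2.2.1 (h i).2.2.2 p
        (near_of_mem_spread (h i).1 hp) q (near_of_mem_spread (h i).1 hq)
    · obtain rfl : u = v := funext hu
      exact ⟨fun i => awayFrom (nextAnchor (τ i) (w i) (u i)) (u i), fun i q hq hd =>
        eq_awayFrom_nextAnchor _ _ _ (h i).1 (h i).2.2.1 (h i).2.2.2 q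
          (near_of_mem_spread (h i).1 hq) hd, ih _ fun i => (h i).next (τ i)⟩

/-! ### The first three rounds -/

/-- The possible coordinates of a robber in the core after the probe of the anchors `false` and then
`true`, where `r` and `s` are the answers less `40`. -/
def coreCoords (r s : ℕ) : Set (Fin 40) :=
  {p | anchorDist false p ≤ r + 1 ∧ r ≤ anchorDist false p + 1 ∧ anchorDist true p = s}

/-- The same for the end of the thread of a robber who entered a thread between these
probes. -/
def threadCoords (r s : ℕ) : Set (Fin 40) :=
  {p | anchorDist false p = r ∧ anchorDist true p + 1 = s}

theorem anchorDist_inj_core_core : ∀ p q : Fin 40,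
    anchorDist false p ≤ anchorDist false q + 2 → anchorDist false q ≤ anchorDist false p + 2 →
    anchorDist true p = anchorDist true q → ∀ p', Near p p' → ∀ q', Near q q' →
    anchorDist (decide (anchorDist true p = 10)) p' =
      anchorDist (decide (anchorDist true p = 10)) q' → p' = q' := by
  decide +kernel

theorem anchorDist_inj_thread_core : ∀ w p : Fin 40,
    anchorDist false p ≤ anchorDist false w + 1 → anchorDist false w ≤ anchorDist false p + 1 →
    anchorDist true p = anchorDist true w + 1 → ∀ q, Near p q →
    anchorDist (decide (anchorDist true p = 10)) w =
      anchorDist (decide (anchorDist true p = 10)) q → w = q := by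
  decide +kernel

theorem anchorDist_injOn_spread (r s : ℕ) :
    Set.InjOn (anchorDist (decide (s = 10))) (spread (coreCoords r s) (threadCoords r s)) := by
  rintro p (⟨hp1, hp2⟩ | ⟨p', ⟨hp1, hp2, rfl⟩, hp⟩) q (⟨hq1, hq2⟩ | ⟨q', ⟨hq1, hq2, hq3⟩, hq⟩) h
  · exact eq_of_anchorDist_eq false (hp1.trans hq1.symm)
      (by rw [Bool.not_false]; omega)
  · subst hq3
    exact anchorDist_inj_thread_core p q' (by omega) (by omega) hp2.symm q hq h
  · exact (anchorDist_inj_thread_core q p' (by omega) (by omega) hq2.symm p hp h.symm).symm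
  · exact anchorDist_inj_core_core p' q' (by omega) (by omega) hq3.symm p hp q hq h

theorem settled_awayFrom : ∀ p : Fin 40,
    Near p (awayFrom (decide (anchorDist true p = 10)) p) ∧
    roundsLeft (awayFrom (decide (anchorDist true p = 10)) p) ≤ 11 ∧
    p ≠ awayFrom (decide (anchorDist true p = 10)) p ∧
    ¬ (p = 10 ∧ awayFrom (decide (anchorDist true p = 10)) p = 9) ∧
    anchorDist (decide (anchorDist true p = 10)) (awayFrom (decide (anchorDist true p = 10)) p) =
      anchorDist (decide (anchorDist true p = 10)) p + 1 := by
  decide +kernel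

theorem exists_along_le_of_move {k : ℕ} {i : Fin k} {b : Bool} {w} {n : ℕ} (h2 : n ≤ 39)
    {y : GVertex k} (h : y = along i b w n ∨ (G k).Adj (along i b w n) y) :
    ∃ w' n', n' ≤ n + 1 ∧ y = along i b w' n' ∧ (n' = 40 → w' = w) := by
  rcases Nat.eq_zero_or_pos n with rfl | h1
  · rcases h with rfl | h
    · exact ⟨w, 0, by omega, rfl, fun _ => rfl⟩
    · obtain ⟨w', rfl⟩ := adj_satellite h
      exact ⟨w', 1, by omega, rfl, by omega⟩
  · obtain ⟨n', -, hn, rfl⟩ := exists_along_of_move h1 h2 h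
    exact ⟨w, n', hn, rfl, fun _ => rfl⟩

/-- After the probes of all anchors `false` and of all anchors `true` that do not show the
robber, he is in the core or at the end of a thread. -/
theorem consistent_consistent_subset_nearCore {k : ℕ} {d e : Fin k → ℕ} (hd : ∀ i, 40 ≤ d i)
    (he : ∀ i, 40 ≤ e i) :
    consistent (G k) (afterMove (G k) (consistent (G k) Set.univ (satProbe fun _ => false) d))
        (satProbe fun _ => true) e ⊆
      nearCore (fun i => coreCoords (d i - 40) (e i - 40))
        (fun i => threadCoords (d i - 40) (e i - 40)) fun _ => false := by
  rintro x ⟨⟨y, ⟨-, hy⟩, hyx⟩, hx⟩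
  have hy' : ∀ j, (G k).dist (.satellite j false) y = d j := hy
  have hx' : ∀ j, (G k).dist (.satellite j true) x = e j := hx
  rcases exists_along y with ⟨v, rfl⟩ | ⟨i, b, w, n, hn, rfl⟩
  · by_cases hc : ∃ u, x = .core u
    · obtain ⟨u, rfl⟩ := hc
      have hnear := eq_or_adj_core_iff.1 (hyx.imp_left fun h => GVertex.core.inj h)
      refine .inl ⟨u, rfl, fun i => ?_⟩
      have h1 := hy' i
      have h2 := hx' i
      rw [dist_satellite_core] at h1 h2
      have h3 := (hnear i).anchorDist_le false
      have h4 := (near_comm.1 (hnear i)).anchorDist_le false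
      refine ⟨?_, ?_, ?_⟩ <;> omega
    · rcases adj_core (hyx.resolve_left fun h => hc ⟨v, h⟩) with h | ⟨i, b, hb, rfl⟩
      · exact absurd h hc
      have hi := hx' i
      cases b with
      | true =>
        rw [dist_satellite_along_self _ _ _ (by omega)] at hi
        have := he i
        omega
      | false =>
        refine .inr ⟨i, _, rfl, fun j => ?_⟩
        have h1 := hy' j
        have h2 := hx' j
        rw [dist_satellite_core] at h1
        rw [dist_satellite_along_of_ne (by simp) _ (by omega) (by omega)] at h2
        simp only at h2 ⊢
        refine ⟨?_, ?_⟩ <;> omega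
  · cases b with
    | false =>
      have hi := hy' i
      rw [dist_satellite_along_self _ _ _ (by omega)] at hi
      have := hd i
      omega
    | true =>
      obtain ⟨w', n', hn', rfl, hw⟩ := exists_along_le_of_move hn hyx
      have hi := hx' i
      rw [dist_satellite_along_self _ _ _ (by omega)] at hi
      have := he i
      obtain rfl : n' = 40 := by omega
      obtain rfl : n = 39 := by omega
      obtain rfl := hw rfl
      refine .inl ⟨w'.1, rfl, fun j => ?_⟩
      have h1 := hy' j
      have h2 := hx' j
      rw [along_forty, dist_satellite_core] at h2
      rw [dist_satellite_along_of_ne (by simp) _ (by omega) (by omega)] at h1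
      refine ⟨?_, ?_, ?_⟩ <;> omega

theorem wins_univ (k : ℕ) : Wins (G k) k Set.univ := by
  refine wins_of_satProbe (fun _ => false) fun d hd => .of_wins ?_
  refine wins_of_satProbe (fun _ => true) fun e he => ?_
  refine WinsAfterProbe.mono (.of_wins ?_) (consistent_consistent_subset_nearCore hd he)
  refine wins_afterMove_nearCore (t := fun i => decide (e i - 40 = 10)) (fun i hi => ?_)
    (fun i => anchorDist_injOn_spread _ _) fun w hw _ => ?_
  · have h : anchorDist true (anchor false) + 1 = e i - 40 := hi.2
    have h' : anchorDist true (anchor false) = 10 := by decide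
    exact decide_eq_false (by omega)
  · have hs : ∀ i, e i - 40 = anchorDist true (w i) := fun i => (hw i).2.2.symm
    refine ⟨fun i => awayFrom (decide (e i - 40 = 10)) (w i), fun i q hq hq' => ?_,
      winsAfterProbe_of_settled 11 _ fun i => ?_⟩
    · obtain ⟨h1, -, -, -, h5⟩ := settled_awayFrom (w i)
      rw [← hs i] at h1 h5
      exact anchorDist_injOn_spread _ _ hq (.inr ⟨_, hw i, h1⟩) (hq'.trans h5.symm)
    · obtain ⟨h1, h2, h3, h4, -⟩ := settled_awayFrom (w i)
      rw [← hs i] at h1 h2 h3 h4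
      exact ⟨h1, h2, h3, h4⟩

theorem not_copsWin_G {k m : ℕ} (h : m < k) : ¬ CopsWin (G k) m := by
  classical
  refine not_copsWin_of_card (Set.range GVertex.core) ⟨_, Set.mem_range_self fun _ => 0⟩ ?_
  rintro _ ⟨v, rfl⟩
  refine ⟨(coreNbhd v).image GVertex.core, ?_, fun w hw => ?_⟩
  · rw [Finset.card_image_of_injective _ fun _ _ h => GVertex.core.inj h, card_coreNbhd]
    exact Nat.pow_lt_pow_right (by norm_num) h
  · obtain ⟨u, hu, rfl⟩ := Finset.mem_image.1 hw
    exact ⟨⟨u, rfl⟩, (eq_or_adj_core_iff.2 (mem_coreNbhd.1 hu)).imp_left (congrArg _)⟩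

theorem localizationNumber_G {k : ℕ} (hk : 1 ≤ k) : localizationNumber (G k) = k := by
  refine le_antisymm (Nat.sInf_le ⟨hk, (wins_univ k).copsWin⟩) ?_
  refine le_csInf ⟨k, hk, (wins_univ k).copsWin⟩ fun m hm => ?_
  by_contra h
  exact not_copsWin_G (not_le.1 h) hm.2

end LocGame

theorem theorem2p4 (k : ℕ) (hk : 1 ≤ k) :
    LocGame.degeneracy (LocGame.G k) = 3 ^ k - 1 ∧
      LocGame.localizationNumber (LocGame.G k) = k :=
  ⟨LocGame.degeneracy_G hk, LocGame.localizationNumber_G hk⟩
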